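/- For a topological space $X$, let $VX$ be the set of continuous valuations on $X$, i.e. maps $\nu:\mathcal O(X)\to[0,\infty]$ with $\nu(\varnothing)=0$ that are monotone, modular ($\nu(U\cup W)+\nu(U\cap W)=\nu(U)+\nu(W)$) and Scott-continuous ($\nu(\bigcup_\lambda U_\lambda)=\sup_\lambda\nu(U_\lambda)$ for directed families), with the topology generated by the sets $\{\nu:\nu(U)>r\}$, $U\subseteq X$ open, $r\in[0,\infty)$. For lower semicontinuous $g:X\to[0,\infty]$ let $\langle\nu,g\rangle=\int g\,d\nu$ be the supremum of $\sum_i r_i\,\nu(U_i)$ over all finite sums $\sum_i r_i 1_{U_i}\le g$ with $U_i$ open and $r_i\in[0,\infty]$ (convention $0\cdot\infty=0$). Let $(V,\delta,\mathcal E)$ be the valuation monad on $\mathbf{Top}$: $V$ acts on continuous maps by pushforward $f_*\nu(U)=\nu(f^{-1}(U))$, $\delta_x(U)=1_U(x)$, and $\mathcal E\xi(U)=\langle\xi,\nu\mapsto\nu(U)\rangle$. For $x\in X$ let $j_x:Y\to X\times Y$, $y\mapsto(x,y)$. **Theorem.** (1) The map $s:X\times VY\to V(X\times Y)$, $s(x,\nu)=(j_x)_*\nu$,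 is continuous. (2) The maps $s$ form a strength for the monad $V$ with respect to the Cartesian monoidal structure of $\mathbf{Top}$: they are natural in $X$ and $Y$ and compatible with the unitor, the associator, $\delta$ and $\mathcal E$. The costrength $t:VX\times Y\to V(X\times Y)$ that $s$ induces through the symmetry is $t(\nu,y)=(x\mapsto(x,y))_*\nu$. (3) $V$ with $s$ is a commutative monad: $$\mathcal E\circ t_*\circ s=\mathcal E\circ s_*\circ t:\;VX\times VY\to V(X\times Y).$$ (4) $(V,\delta,\mathcal E)$ is a symmetric monoidal monad, with the structure that corresponds to $s$: the maps $\nabla=\mathcal E\circ t_*\circ s:VX\times VY\to V(X\times Y)$ and $\delta:1\to V1$ make $V$ a lax symmetric monoidal functor such that $\nabla\circ(\delta\times\delta)=\delta$ and $\mathcal E\circ\nabla_*\circ\nabla=\nabla\circ(\mathcal E\times\mathcal E)$, and $s=\nabla\circ(\delta\times\mathrm{id})$. (5) Write $\nu\otimes\rho=\nabla(\nu,\rho)$ for $\nu\in VX$, $\rho\in VY$. Then $(\nu\otimes\rho)(U\times W)=\nu(U)\,\rho(W)$ for all open $U\subseteq X$, $W\subseteq Y$; $\langle\nu\otimes\rho,\,(x,y)\mapsto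 g(x)h(y)\rangle=\langle\nu,g\rangle\langle\rho,h\rangle$ for all lower semicontinuous $g:X\to[0,\infty]$, $h:Y\to[0,\infty]$; and (Fubini) for every lower semicontinuous $f:X\times Y\to[0,\infty]$ $$\int f\,d(\nu\otimes\rho)=\int\!\int f(x,y)\,d\rho(y)\,d\nu(x)=\int\!\int f(x,y)\,d\nu(x)\,d\rho(y).$$ -/

import Mathlib

open TopologicalSpace CategoryTheory MonoidalCategory
open scoped ENNReal NNReal

universe u

/-- A continuous valuation on `X` with values in `[0,∞]`. -/
structure ContinuousValuation (X : Type*) [TopologicalSpace X] where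
  toFun : Opens X → ℝ≥0∞
  strict' : toFun ⊥ = 0
  mono' : Monotone toFun
  modular' : ∀ U V : Opens X, toFun (U ⊔ V) + toFun (U ⊓ V) = toFun U + toFun V
  scott' : ∀ D : Set (Opens X), D.Nonempty → DirectedOn (· ≤ ·) D →
    toFun (sSup D) = ⨆ U ∈ D, toFun U

namespace ContinuousValuation

variable {X Y Z : Type*} [TopologicalSpace X] [TopologicalSpace Y] [TopologicalSpace Z]

instance : CoeFun (ContinuousValuation X) fun _ => Opens X → ℝ≥0∞ := ⟨toFun⟩

@[ext]
theorem ext {ν ρ : ContinuousValuation X} (h : ∀ U, ν U = ρ U) : ν = ρ := by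
  obtain ⟨f, _, _, _, _⟩ := ν
  obtain ⟨g, _, _, _, _⟩ := ρ
  obtain rfl : f = g := funext h
  rfl

/-- The indicator function of an open set. -/
noncomputable def ind (U : Opens X) : X → ℝ≥0∞ := (U : Set X).indicator 1

/-- The integral (pairing) `⟨ν, g⟩`, meant for lower semicontinuous `g`: the supremum of
`∑ i, r i * ν (U i)` over all simple lower semicontinuous functions
`∑ i, r i * 1_{U i}` that lie below `g`. -/
noncomputable def integral (ν : ContinuousValuation X) (g : X → ℝ≥0∞) : ℝ≥0∞ :=
  sSup {a | ∃ (n : ℕ) (r : Fin n → ℝ≥0∞) (U : Fin n → Opens X),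
    (∀ x, ∑ i, r i * ind (U i) x ≤ g x) ∧ a = ∑ i, r i * ν (U i)}

/-- The topology on the set of continuous valuations, generated by the sets
`{ν | r < ν U}` for `U` open and `r ∈ [0,∞)`. -/
instance : TopologicalSpace (ContinuousValuation X) :=
  generateFrom {S | ∃ (U : Opens X) (r : ℝ≥0), S = {ν | (r : ℝ≥0∞) < ν U}}

/-- The pushforward `f_* ν (U) = ν (f ⁻¹ U)`. -/
def map (f : C(X, Y)) (ν : ContinuousValuation X) : ContinuousValuation Y where
  toFun U := ν (Opens.comap f U)
  strict' := ν.strict'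
  mono' _ _ h := ν.mono' (Opens.comap_mono f h)
  modular' U V := ν.modular' (Opens.comap f U) (Opens.comap f V)
  scott' D hD hdir := by
    have h := ν.scott' (Opens.comap f '' D) (hD.image _)
      (hdir.mono_comp (fun _ _ h => Opens.comap_mono f h))
    rw [iSup_image] at h
    rw [← h, map_sSup, sSup_image]

@[simp]
theorem map_apply (f : C(X, Y)) (ν : ContinuousValuation X) (U : Opens Y) :
    map f ν U = ν (Opens.comap f U) := rfl

/-! ### Integration: auxiliary facts -/

@[simp]
theorem ind_of_mem {U : Opens X} {x : X} (h : x ∈ U) : ind U x = 1 :=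
  Set.indicator_of_mem (s := (U : Set X)) h _

@[simp]
theorem ind_of_notMem {U : Opens X} {x : X} (h : x ∉ U) : ind U x = 0 :=
  Set.indicator_of_notMem (s := (U : Set X)) h _

theorem lsc_mul_ind (r : ℝ≥0∞) (U : Opens X) : LowerSemicontinuous fun x => r * ind U x := by
  have h : (fun x => r * ind U x) = (U : Set X).indicator fun _ => r := by
    ext x
    by_cases hx : x ∈ U
    · simp [hx]
    · simp [hx]
  rw [h]
  exact U.isOpen.lowerSemicontinuous_indicator bot_le

theorem lsc_sum_ind {ι : Type*} (s : Finset ι) (r : ι → ℝ≥0∞) (U : ι → Opens X) :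
    LowerSemicontinuous fun x => ∑ i ∈ s, r i * ind (U i) x :=
  lowerSemicontinuous_sum fun i _ => lsc_mul_ind (r i) (U i)

/-- The superlevel set `{g > t}` of a lower semicontinuous function (its interior in general). -/
def level (g : X → ℝ≥0∞) (t : ℝ≥0∞) : Opens X := Opens.interior {x | t < g x}

theorem mem_level {g : X → ℝ≥0∞} (hg : LowerSemicontinuous g) {t : ℝ≥0∞} {x : X} :
    x ∈ level g t ↔ t < g x := by
  have : IsOpen {x | t < g x} := hg.isOpen_preimage t
  change x ∈ interior _ ↔ _
  rw [this.interior_eq]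
  rfl

theorem level_anti (g : X → ℝ≥0∞) : Antitone (level g) := fun _ _ h =>
  interior_mono fun _ hx => lt_of_le_of_lt h hx

theorem level_mono {f g : X → ℝ≥0∞} (h : f ≤ g) (t : ℝ≥0∞) : level f t ≤ level g t :=
  interior_mono fun x hx => lt_of_lt_of_le hx (h x)

theorem level_comp (f : C(X, Y)) {g : Y → ℝ≥0∞} (hg : LowerSemicontinuous g) (t : ℝ≥0∞) :
    level (g ∘ f) t = Opens.comap f (level g t) := by
  ext x
  exact (mem_level (hg.comp f.continuous)).trans (mem_level hg).symm

theorem apply_iSup {ι : Type*} [Nonempty ι] (ν : ContinuousValuation X) {U : ι → Opens X}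
    (hU : Directed (· ≤ ·) U) : ν (⨆ i, U i) = ⨆ i, ν (U i) := by
  have h := ν.scott' (Set.range U) (Set.range_nonempty U) hU.directedOn_range
  rw [iSup_range] at h
  exact h

theorem level_iSup {ι : Type*} {g : ι → X → ℝ≥0∞} (hg : ∀ i, LowerSemicontinuous (g i))
    (t : ℝ≥0∞) : level (fun x => ⨆ i, g i x) t = ⨆ i, level (g i) t := by
  ext x
  refine (mem_level (lowerSemicontinuous_iSup hg)).trans ?_
  simp only [SetLike.mem_coe, Opens.mem_iSup, mem_level (hg _)]
  exact lt_iSup_iff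

theorem apply_level_iSup {ι : Type*} [Nonempty ι] (ν : ContinuousValuation X)
    {g : ι → X → ℝ≥0∞} (hg : ∀ i, LowerSemicontinuous (g i)) (hd : Directed (· ≤ ·) g)
    (t : ℝ≥0∞) : ν (level (fun x => ⨆ i, g i x) t) = ⨆ i, ν (level (g i) t) := by
  rw [level_iSup hg]
  exact ν.apply_iSup fun i j => (hd i j).imp fun k hk =>
    ⟨level_mono hk.1 t, level_mono hk.2 t⟩

/-- The layer-cake formula for the integral. -/
noncomputable def layer (ν : ContinuousValuation X) (g : X → ℝ≥0∞) : ℝ≥0∞ :=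
  ∫⁻ t in Set.Ioi (0 : ℝ), ν (level g (ENNReal.ofReal t))

theorem measurable_level (ν : ContinuousValuation X) (g : X → ℝ≥0∞) :
    Measurable fun t : ℝ => ν (level g (ENNReal.ofReal t)) :=
  Antitone.measurable fun _ _ h => ν.mono' (level_anti g (ENNReal.ofReal_le_ofReal h))

theorem layer_mono (ν : ContinuousValuation X) {f g : X → ℝ≥0∞} (h : f ≤ g) :
    ν.layer f ≤ ν.layer g :=
  MeasureTheory.lintegral_mono fun _ => ν.mono' (level_mono h _)

theorem layer_iSup_nat (ν : ContinuousValuation X) {g : ℕ → X → ℝ≥0∞}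
    (hg : ∀ n, LowerSemicontinuous (g n)) (hm : Monotone g) :
    ν.layer (fun x => ⨆ n, g n x) = ⨆ n, ν.layer (g n) := by
  unfold layer
  rw [← MeasureTheory.lintegral_iSup (fun n => ν.measurable_level (g n))
    (fun m n h t => ν.mono' (level_mono (hm h) _))]
  exact MeasureTheory.lintegral_congr fun t => ν.apply_level_iSup hg hm.directed_le _

theorem layer_add_ind (ν : ContinuousValuation X) {f : X → ℝ≥0∞} (hf : LowerSemicontinuous f)
    (r : ℝ≥0∞) (U : Opens X) :
    ν.layer (fun x => f x + r * ind U x) = ν.layer f + r * ν U := by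
  classical
  have hg : LowerSemicontinuous fun x => f x + r * ind U x := hf.add (lsc_mul_ind r U)
  let B : ℝ≥0∞ → Opens X := fun t => if t < r then U else U ⊓ level f (t - r)
  have hB : ∀ t x, x ∈ B t ↔ x ∈ U ∧ (t < r ∨ t - r < f x) := by
    intro t x
    by_cases h : t < r
    · simp [B, h]
    · simp [B, h, mem_level hf]
  have hle : f ≤ fun x => f x + r * ind U x := fun x => le_self_add
  have key : ∀ t : ℝ≥0∞, t ≠ ∞ → ν (level (fun x => f x + r * ind U x) t) + ν (U ⊓ level f t)
      = ν (level f t) + ν (B t) := by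
    intro t ht
    rw [← ν.modular' (level f t) (B t)]
    congr 2
    · ext x
      simp only [SetLike.mem_coe, mem_level hg, Opens.coe_sup, Set.mem_union, hB, mem_level hf]
      by_cases hx : x ∈ U
      · simp only [ind_of_mem hx, mul_one, hx, true_and]
        rcases lt_or_ge t r with h | h
        · simp only [h, true_or, or_true, iff_true]
          exact lt_of_lt_of_le h le_add_self
        · have hr : r ≠ ∞ := ne_top_of_le_ne_top ht h
          rw [ENNReal.sub_lt_iff_lt_right hr h]
          simp only [not_lt.2 h, false_or]
          exact ⟨Or.inr, fun h' => h'.elim (fun h'' => lt_of_lt_of_le h'' le_self_add) id⟩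
      · simp [hx]
    · ext x
      simp only [SetLike.mem_coe, Opens.coe_inf, Set.mem_inter_iff, hB, mem_level hf]
      constructor
      · rintro ⟨hU, hx⟩
        exact ⟨hx, hU, Or.inr (lt_of_le_of_lt tsub_le_self hx)⟩
      · rintro ⟨hx, hU, -⟩
        exact ⟨hU, hx⟩
  have mK : Measurable fun t : ℝ => ν (U ⊓ level f (ENNReal.ofReal t)) :=
    Antitone.measurable fun _ _ h => ν.mono'
      (inf_le_inf_left _ (level_anti f (ENNReal.ofReal_le_ofReal h)))
  set K := ∫⁻ t in Set.Ioi (0 : ℝ), ν (U ⊓ level f (ENNReal.ofReal t)) with hK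
  have hint : ν.layer (fun x => f x + r * ind U x) + K =
      ν.layer f + ∫⁻ t in Set.Ioi (0 : ℝ), ν (B (ENNReal.ofReal t)) := by
    unfold layer
    rw [hK, ← MeasureTheory.lintegral_add_right _ mK,
      ← MeasureTheory.lintegral_add_left (ν.measurable_level f)]
    exact MeasureTheory.lintegral_congr fun t => key _ ENNReal.ofReal_ne_top
  have hBint : ∫⁻ t in Set.Ioi (0 : ℝ), ν (B (ENNReal.ofReal t)) = r * ν U + K := by
    rcases eq_or_ne r ∞ with rfl | hr
    · have h1 : ∫⁻ t in Set.Ioi (0 : ℝ), ν (B (ENNReal.ofReal t)) = ∞ * ν U := by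
        simp [B, mul_comm]
      rw [h1]
      rcases eq_or_ne (ν U) 0 with h0 | h0
      · have : K = 0 := by
          rw [hK]
          refine (MeasureTheory.lintegral_congr fun t => ?_).trans MeasureTheory.lintegral_zero
          exact le_antisymm ((ν.mono' inf_le_left).trans h0.le) bot_le
        rw [this, add_zero]
      · simp [ENNReal.top_mul h0]
    · lift r to ℝ≥0 using hr
      have hr0 : (0 : ℝ) ≤ r := r.2
      rw [← Set.Ioc_union_Ioi_eq_Ioi hr0, MeasureTheory.lintegral_union measurableSet_Ioi
        (Set.disjoint_left.2 fun t h h' => not_lt.2 h.2 h')]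
      congr 1
      · rw [← MeasureTheory.setLIntegral_congr MeasureTheory.Ioo_ae_eq_Ioc]
        have : Set.EqOn (fun t : ℝ => ν (B (ENNReal.ofReal t))) (fun _ => ν U)
            (Set.Ioo (0 : ℝ) r) := by
          intro t ht
          have h : ENNReal.ofReal t < r := by
            rw [← ENNReal.ofReal_coe_nnreal]
            exact (ENNReal.ofReal_lt_ofReal_iff_of_nonneg ht.1.le).2 ht.2
          simp [B, h]
        rw [MeasureTheory.setLIntegral_congr_fun measurableSet_Ioo this]
        simp [mul_comm]
      · have hpre : (fun t : ℝ => t - r) ⁻¹' Set.Ioi 0 = Set.Ioi (r : ℝ) := by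
          ext t
          simp
        rw [hK, ← (MeasureTheory.measurePreserving_sub_right MeasureTheory.volume
          (r : ℝ)).setLIntegral_comp_preimage measurableSet_Ioi mK, hpre]
        refine MeasureTheory.setLIntegral_congr_fun measurableSet_Ioi fun t ht => ?_
        have h : ¬ ENNReal.ofReal t < r := not_lt.2 <| by
          rw [← ENNReal.ofReal_coe_nnreal]
          exact ENNReal.ofReal_le_ofReal (le_of_lt ht)
        simp only [B, h, if_false]
        rw [ENNReal.ofReal_sub _ hr0, ENNReal.ofReal_coe_nnreal]
  rcases eq_or_ne K ∞ with hKt | hKt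
  · have h1 : ν.layer f = ∞ := by
      rw [← top_le_iff, ← hKt]
      exact MeasureTheory.lintegral_mono fun _ => ν.mono' inf_le_right
    have h2 := ν.layer_mono hle
    rw [h1, top_le_iff] at h2
    rw [h1, h2, top_add]
  · rw [hBint, ← add_assoc] at hint
    exact (ENNReal.add_left_inj hKt).1 hint

theorem layer_zero (ν : ContinuousValuation X) : ν.layer (fun _ => 0) = 0 := by
  have h : ∀ t : ℝ≥0∞, ν (level (fun _ : X => (0 : ℝ≥0∞)) t) = 0 := by
    intro t
    have : level (fun _ : X => (0 : ℝ≥0∞)) t = ⊥ := by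
      ext x
      simp [mem_level (lowerSemicontinuous_const (α := X) (z := (0 : ℝ≥0∞)))]
    rw [this]
    exact ν.strict'
  simp [layer, h]

theorem layer_add_sum {ι : Type*} (ν : ContinuousValuation X) {f : X → ℝ≥0∞}
    (hf : LowerSemicontinuous f) (s : Finset ι) (r : ι → ℝ≥0∞) (U : ι → Opens X) :
    ν.layer (fun x => f x + ∑ i ∈ s, r i * ind (U i) x) =
      ν.layer f + ∑ i ∈ s, r i * ν (U i) := by
  classical
  induction s using Finset.induction_on with
  | empty => simp
  | insert i s hi ih =>
    have h : (fun x => f x + ∑ j ∈ insert i s, r j * ind (U j) x) =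
        fun x => (f x + ∑ j ∈ s, r j * ind (U j) x) + r i * ind (U i) x := by
      ext x
      rw [Finset.sum_insert hi, add_assoc, add_comm (r i * _)]
    rw [h, ν.layer_add_ind (hf.add (lsc_sum_ind s r U)), ih, Finset.sum_insert hi, add_assoc,
      add_comm (r i * _)]

theorem layer_sum {ι : Type*} (ν : ContinuousValuation X) (s : Finset ι) (r : ι → ℝ≥0∞)
    (U : ι → Opens X) :
    ν.layer (fun x => ∑ i ∈ s, r i * ind (U i) x) = ∑ i ∈ s, r i * ν (U i) := by
  have h := ν.layer_add_sum (lowerSemicontinuous_const (z := (0 : ℝ≥0∞))) s r U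
  simpa [ν.layer_zero] using h

/-- The dyadic approximations of a lower semicontinuous function from below. -/
noncomputable def approx (g : X → ℝ≥0∞) (n : ℕ) (x : X) : ℝ≥0∞ :=
  ∑ k ∈ Finset.range (4 ^ n), (2 ^ n)⁻¹ * ind (level g ((k + 1) / 2 ^ n)) x

theorem lsc_approx (g : X → ℝ≥0∞) (n : ℕ) : LowerSemicontinuous (approx g n) :=
  lsc_sum_ind _ _ _

theorem ind_anti {U V : Opens X} (h : U ≤ V) (x : X) : ind U x ≤ ind V x := by
  by_cases hx : x ∈ U
  · rw [ind_of_mem hx, ind_of_mem (h hx)]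
  · rw [ind_of_notMem hx]
    exact bot_le

theorem approx_mono (g : X → ℝ≥0∞) : Monotone (approx g) := by
  have hsum : ∀ (a : ℕ → ℝ≥0∞) (m : ℕ),
      ∑ k ∈ Finset.range (2 * m), a k = ∑ k ∈ Finset.range m, (a (2 * k) + a (2 * k + 1)) := by
    intro a m
    induction m with
    | zero => simp
    | succ m ih =>
      rw [Finset.sum_range_succ, ← ih, show 2 * (m + 1) = 2 * m + 1 + 1 by ring,
        Finset.sum_range_succ, Finset.sum_range_succ, add_assoc]
  refine monotone_nat_of_le_succ fun n x => ?_
  have hsub : Finset.range (2 * 4 ^ n) ⊆ Finset.range (4 ^ (n + 1)) := by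
    apply Finset.range_mono
    rw [pow_succ]
    lia
  refine le_trans ?_ (Finset.sum_le_sum_of_subset hsub)
  rw [hsum]
  refine Finset.sum_le_sum fun k _ => ?_
  have h2 : ((2 : ℝ≥0∞) ^ n)⁻¹ = (2 ^ (n + 1))⁻¹ + (2 ^ (n + 1))⁻¹ := by
    rw [pow_succ, ENNReal.mul_inv (by simp) (by simp), ← mul_add, ENNReal.inv_two_add_inv_two,
      mul_one]
  have h3 : ((2 * k + 1 : ℕ) + 1 : ℝ≥0∞) / 2 ^ (n + 1) = (k + 1) / 2 ^ n := by
    rw [pow_succ, show ((2 * k + 1 : ℕ) + 1 : ℝ≥0∞) = (k + 1) * 2 by push_cast; ring]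
    exact ENNReal.mul_div_mul_right _ _ (by simp) (by simp)
  rw [h2, add_mul, h3]
  refine add_le_add ?_ le_rfl
  refine mul_le_mul_right (ind_anti (level_anti g ?_) x) _
  rw [← h3]
  refine ENNReal.div_le_div_right ?_ _
  norm_cast
  lia

theorem approx_le {g : X → ℝ≥0∞} (hg : LowerSemicontinuous g) (n : ℕ) (x : X) :
    approx g n x ≤ g x := by
  have key : ∀ m : ℕ,
      ∑ k ∈ Finset.range m, (2 ^ n)⁻¹ * ind (level g ((k + 1) / 2 ^ n)) x ≤ g x := by
    intro m
    induction m with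
    | zero => simp
    | succ m ih =>
      by_cases hx : x ∈ level g ((m + 1) / 2 ^ n)
      · refine le_trans ?_ ((mem_level hg).1 hx).le
        refine (Finset.sum_le_sum (g := fun _ => ((2 : ℝ≥0∞) ^ n)⁻¹) fun k _ => ?_).trans ?_
        · refine mul_le_of_le_one_right' ?_
          exact Set.indicator_le_self' (fun _ _ => bot_le) x
        · simp [div_eq_mul_inv]
      · rw [Finset.sum_range_succ, ind_of_notMem hx, mul_zero, add_zero]
        exact ih
  exact key _

theorem iSup_approx {g : X → ℝ≥0∞} (hg : LowerSemicontinuous g) (x : X) :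
    ⨆ n, approx g n x = g x := by
  refine le_antisymm (iSup_le fun n => approx_le hg n x) ?_
  refine le_of_forall_lt_imp_le_of_dense fun c hc => ?_
  lift c to ℝ≥0 using ne_top_of_lt hc
  obtain ⟨d, hcd, hd⟩ := ENNReal.lt_iff_exists_nnreal_btwn.1 hc
  have hcd' : c < d := by exact_mod_cast hcd
  have hpos : (0 : ℝ≥0) < d - c := tsub_pos_of_lt hcd'
  obtain ⟨n₁, hn₁⟩ := exists_pow_lt_of_lt_one hpos (show (2 : ℝ≥0)⁻¹ < 1 from
    inv_lt_one_of_one_lt₀ one_lt_two)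
  obtain ⟨n₂, hn₂⟩ := pow_unbounded_of_one_lt c (one_lt_two : (1 : ℝ≥0) < 2)
  let n := max n₁ n₂
  have hn1 : ((2 : ℝ≥0) ^ n)⁻¹ ≤ d - c := by
    rw [← inv_pow]
    exact (pow_le_pow_of_le_one bot_le (inv_le_one_of_one_le₀ one_le_two)
      (le_max_left n₁ n₂)).trans hn₁.le
  have hn2 : c ≤ 2 ^ n := hn₂.le.trans (pow_le_pow_right₀ one_le_two (le_max_right n₁ n₂))
  have h2 : (0 : ℝ≥0) < 2 ^ n := by positivity
  let m := ⌈c * 2 ^ n⌉₊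
  have hm : m ≤ 4 ^ n := by
    refine Nat.ceil_le.2 ?_
    push_cast
    rw [show (4 : ℝ≥0) = 2 * 2 by norm_num, mul_pow]
    exact mul_le_mul_left hn2 _
  have hcm : c ≤ m * (2 ^ n)⁻¹ := by
    rw [← div_eq_mul_inv, le_div_iff₀ h2]
    exact Nat.le_ceil _
  have hmd : (m : ℝ≥0) / 2 ^ n ≤ d := by
    rw [div_le_iff₀ h2]
    refine (Nat.ceil_lt_add_one bot_le).le.trans ?_
    have : c + (2 ^ n)⁻¹ ≤ d := by
      rw [add_comm]
      exact (add_le_add_left hn1 c).trans (tsub_add_cancel_of_le hcd'.le).le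
    calc c * 2 ^ n + 1 = (c + (2 ^ n)⁻¹) * 2 ^ n := by
          rw [add_mul, inv_mul_cancel₀ h2.ne']
      _ ≤ d * 2 ^ n := mul_le_mul_left this _
  refine le_trans ?_ (le_iSup _ n)
  refine le_trans ?_ (Finset.sum_le_sum_of_subset (Finset.range_mono hm))
  have hone : ∀ k ∈ Finset.range m,
      ((2 : ℝ≥0∞) ^ n)⁻¹ * ind (level g ((k + 1) / 2 ^ n)) x = (2 ^ n)⁻¹ := by
    intro k hk
    rw [ind_of_mem, mul_one]
    refine (mem_level hg).2 (lt_of_le_of_lt ?_ hd)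
    have h1 : ((k : ℝ≥0) + 1) / 2 ^ n ≤ d := by
      refine le_trans ?_ hmd
      refine div_le_div_of_nonneg_right ?_ h2.le
      exact_mod_cast Finset.mem_range.1 hk
    have h3 : ((((k : ℝ≥0) + 1) / 2 ^ n : ℝ≥0) : ℝ≥0∞) ≤ d := by exact_mod_cast h1
    rw [ENNReal.coe_div h2.ne'] at h3
    simpa using h3
  rw [Finset.sum_congr rfl hone]
  have h4 : (c : ℝ≥0∞) ≤ ((m * (2 ^ n)⁻¹ : ℝ≥0) : ℝ≥0∞) := by exact_mod_cast hcm
  rw [ENNReal.coe_mul, ENNReal.coe_inv h2.ne'] at h4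
  simpa using h4

/-- The integral agrees with the layer-cake formula. -/
theorem integral_eq_layer (ν : ContinuousValuation X) {g : X → ℝ≥0∞}
    (hg : LowerSemicontinuous g) : ν.integral g = ν.layer g := by
  refine le_antisymm (sSup_le ?_) ?_
  · rintro _ ⟨n, r, U, h, rfl⟩
    rw [← ν.layer_sum]
    exact ν.layer_mono h
  · have h : g = fun x => ⨆ n, approx g n x := funext fun x => (iSup_approx hg x).symm
    conv_lhs => rw [h]
    rw [ν.layer_iSup_nat (lsc_approx g) (approx_mono g)]
    refine iSup_le fun n => le_sSup ⟨4 ^ n, fun _ => (2 ^ n)⁻¹,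
      fun k => level g (((k : ℕ) + 1) / 2 ^ n), fun x => ?_, ?_⟩
    · rw [Fin.sum_univ_eq_sum_range
        (fun k => ((2 : ℝ≥0∞) ^ n)⁻¹ * ind (level g (((k : ℕ) + 1) / 2 ^ n)) x)]
      exact approx_le hg n x
    · rw [Fin.sum_univ_eq_sum_range
        (fun k => ((2 : ℝ≥0∞) ^ n)⁻¹ * ν (level g (((k : ℕ) + 1) / 2 ^ n)))]
      exact ν.layer_sum _ _ _

theorem integral_sum_ind {ι : Type*} (ν : ContinuousValuation X) (s : Finset ι) (r : ι → ℝ≥0∞)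
    (U : ι → Opens X) :
    ν.integral (fun x => ∑ i ∈ s, r i * ind (U i) x) = ∑ i ∈ s, r i * ν (U i) := by
  rw [ν.integral_eq_layer (lsc_sum_ind s r U), ν.layer_sum]

theorem integral_eq_iSup (ν : ContinuousValuation X) {g : X → ℝ≥0∞}
    (hg : LowerSemicontinuous g) : ν.integral g =
      ⨆ n : ℕ, ∑ k ∈ Finset.range (4 ^ n), (2 ^ n)⁻¹ * ν (level g ((k + 1) / 2 ^ n)) := by
  have h : g = fun x => ⨆ n, approx g n x := funext fun x => (iSup_approx hg x).symm
  rw [ν.integral_eq_layer hg]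
  conv_lhs => rw [h]
  rw [ν.layer_iSup_nat (lsc_approx g) (approx_mono g)]
  exact iSup_congr fun n => ν.layer_sum _ _ _

theorem integral_iSup {ι : Type*} [Nonempty ι] (ν : ContinuousValuation X)
    {g : ι → X → ℝ≥0∞} (hg : ∀ i, LowerSemicontinuous (g i)) (hd : Directed (· ≤ ·) g) :
    ν.integral (fun x => ⨆ i, g i x) = ⨆ i, ν.integral (g i) := by
  simp only [ν.integral_eq_iSup (lowerSemicontinuous_iSup hg), ν.integral_eq_iSup (hg _)]
  rw [iSup_comm]
  refine iSup_congr fun n => ?_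
  rw [← ENNReal.finsetSum_iSup]
  · exact Finset.sum_congr rfl fun k _ => by
      rw [ν.apply_level_iSup hg hd, ENNReal.mul_iSup]
  · exact fun i j => (hd i j).imp fun k hk a =>
      ⟨mul_le_mul_right (ν.mono' (level_mono hk.1 _)) _,
        mul_le_mul_right (ν.mono' (level_mono hk.2 _)) _⟩

theorem integral_add (ν : ContinuousValuation X) {f g : X → ℝ≥0∞}
    (hf : LowerSemicontinuous f) (hg : LowerSemicontinuous g) :
    ν.integral (fun x => f x + g x) = ν.integral f + ν.integral g := by
  have h : (fun x => f x + g x) = fun x => ⨆ n, f x + approx g n x := by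
    ext x
    rw [← ENNReal.add_iSup, iSup_approx hg]
  rw [h, ν.integral_iSup (fun n => hf.add (lsc_approx g n))
    (Monotone.directed_le fun m n hmn x => add_le_add le_rfl (approx_mono g hmn x)),
    ν.integral_eq_iSup hg, ENNReal.add_iSup]
  refine iSup_congr fun n => ?_
  rw [ν.integral_eq_layer (hf.add (lsc_approx g n)), ν.integral_eq_layer hf]
  exact ν.layer_add_sum hf _ _ _

theorem integral_ind (ν : ContinuousValuation X) (U : Opens X) : ν.integral (ind U) = ν U := by
  have h := ν.integral_sum_ind {()} (fun _ => 1) (fun _ => U)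
  simpa using h

theorem lsc_const_mul (c : ℝ≥0∞) {g : X → ℝ≥0∞} (hg : LowerSemicontinuous g) :
    LowerSemicontinuous fun x => c * g x := by
  have h : (fun x => c * g x) = fun x => ⨆ n, c * approx g n x := by
    ext x
    rw [← ENNReal.mul_iSup, iSup_approx hg]
  rw [h]
  refine lowerSemicontinuous_iSup fun n => ?_
  simp only [approx, Finset.mul_sum, ← mul_assoc]
  exact lsc_sum_ind _ _ _

theorem integral_const_mul (ν : ContinuousValuation X) (c : ℝ≥0∞) {g : X → ℝ≥0∞}
    (hg : LowerSemicontinuous g) : ν.integral (fun x => c * g x) = c * ν.integral g := by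
  have h : (fun x => c * g x) = fun x => ⨆ n, c * approx g n x := by
    ext x
    rw [← ENNReal.mul_iSup, iSup_approx hg]
  rw [h, ν.integral_iSup (fun n => lsc_const_mul c (lsc_approx g n))
    (Monotone.directed_le fun m n hmn x => mul_le_mul_right (approx_mono g hmn x) _),
    ν.integral_eq_iSup hg, ENNReal.mul_iSup]
  refine iSup_congr fun n => ?_
  simp only [approx, Finset.mul_sum, ← mul_assoc]
  exact ν.integral_sum_ind _ _ _

theorem integral_finsetSum {ι : Type*} (ν : ContinuousValuation X) (s : Finset ι)
    {g : ι → X → ℝ≥0∞} (hg : ∀ i, LowerSemicontinuous (g i)) :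
    ν.integral (fun x => ∑ i ∈ s, g i x) = ∑ i ∈ s, ν.integral (g i) := by
  classical
  induction s using Finset.induction_on with
  | empty =>
    have h := ν.integral_sum_ind (∅ : Finset ℕ) 0 (fun _ => ⊥)
    simpa using h
  | insert i s hi ih =>
    simp only [Finset.sum_insert hi]
    rw [ν.integral_add (hg i) (lowerSemicontinuous_sum fun j _ => hg j), ih]

theorem integral_map (f : C(X, Y)) (ν : ContinuousValuation X) {g : Y → ℝ≥0∞}
    (hg : LowerSemicontinuous g) : (ν.map f).integral g = ν.integral (g ∘ f) := by
  rw [integral_eq_iSup _ hg, integral_eq_iSup _ (hg.comp f.continuous)]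
  simp only [level_comp f hg, map_apply]

/-! ### The monad structure -/

theorem lsc_apply (U : Opens X) : LowerSemicontinuous fun ν : ContinuousValuation X => ν U := by
  refine lowerSemicontinuous_iff_isOpen_preimage.2 fun y => ?_
  rcases eq_or_ne y ∞ with rfl | hy
  · simp
  · lift y to ℝ≥0 using hy
    exact isOpen_generateFrom_of_mem ⟨U, y, rfl⟩

theorem continuous_iff_lsc {f : X → ContinuousValuation Y} :
    Continuous f ↔ ∀ U : Opens Y, LowerSemicontinuous fun x => f x U := by
  constructor
  · exact fun hf U => (lsc_apply U).comp hf
  · intro h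
    refine continuous_generateFrom_iff.2 ?_
    rintro _ ⟨U, r, rfl⟩
    exact (h U).isOpen_preimage (r : ℝ≥0∞)

theorem lsc_integral {g : X → ℝ≥0∞} (hg : LowerSemicontinuous g) :
    LowerSemicontinuous fun ν : ContinuousValuation X => ν.integral g := by
  simp only [integral_eq_iSup _ hg]
  exact lowerSemicontinuous_iSup fun n => lowerSemicontinuous_sum fun k _ =>
    lsc_const_mul _ (lsc_apply _)

theorem continuous_map (f : C(X, Y)) : Continuous (map f) :=
  continuous_iff_lsc.2 fun U => lsc_apply (Opens.comap f U)

/-- The point valuation `δ_x`, given by `δ_x (U) = 1_U (x)`. -/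
noncomputable def dirac (x : X) : ContinuousValuation X where
  toFun U := ind U x
  strict' := ind_of_notMem (U := ⊥) (x := x) (by simp)
  mono' _ _ h := ind_anti h x
  modular' U V := by
    by_cases hU : x ∈ U <;> by_cases hV : x ∈ V <;> simp [ind, hU, hV]
  scott' D _ _ := by
    by_cases h : x ∈ sSup D
    · rw [ind_of_mem h]
      obtain ⟨U, hU, hx⟩ := Opens.mem_sSup.1 h
      refine le_antisymm ?_ (iSup₂_le fun V _ => ?_)
      · exact le_iSup₂_of_le U hU (ind_of_mem hx).ge
      · exact Set.indicator_le_self' (fun _ _ => bot_le) x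
    · rw [ind_of_notMem h]
      refine le_antisymm bot_le (iSup₂_le fun V hV => ?_)
      rw [ind_of_notMem fun hx => h (Opens.mem_sSup.2 ⟨V, hV, hx⟩)]

@[simp]
theorem dirac_apply (x : X) (U : Opens X) : dirac x U = ind U x := rfl

theorem integral_dirac (x : X) {g : X → ℝ≥0∞} (hg : LowerSemicontinuous g) :
    (dirac x).integral g = g x := by
  rw [integral_eq_iSup _ hg, ← iSup_approx hg x]
  rfl

theorem continuous_dirac : Continuous (dirac : X → ContinuousValuation X) :=
  continuous_iff_lsc.2 fun U => by simpa using lsc_mul_ind 1 U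

/-- The multiplication `𝓔 ξ`, given by `𝓔 ξ (U) = ⟨ξ, ν ↦ ν U⟩`. -/
noncomputable def join (ξ : ContinuousValuation (ContinuousValuation X)) :
    ContinuousValuation X where
  toFun U := ξ.integral fun ν => ν U
  strict' := by
    have h := ξ.integral_const_mul 0 (lsc_apply (⊥ : Opens X))
    simpa [strict'] using h
  mono' U V h := by
    change ξ.integral _ ≤ ξ.integral _
    rw [ξ.integral_eq_layer (lsc_apply U), ξ.integral_eq_layer (lsc_apply V)]
    exact ξ.layer_mono fun ν => ν.mono' h
  modular' U V := by
    rw [← ξ.integral_add (lsc_apply _) (lsc_apply _), ← ξ.integral_add (lsc_apply _) (lsc_apply _)]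
    simp only [modular']
  scott' D hD hdir := by
    have := hD.to_subtype
    rw [iSup_subtype', ← ξ.integral_iSup (fun U : D => lsc_apply U.1)]
    · simp only [fun ν : ContinuousValuation X => ν.scott' D hD hdir, iSup_subtype']
    · exact fun U V => (hdir.directed_val U V).imp fun W hW =>
        ⟨fun ν => ν.mono' hW.1, fun ν => ν.mono' hW.2⟩

@[simp]
theorem join_apply (ξ : ContinuousValuation (ContinuousValuation X)) (U : Opens X) :
    join ξ U = ξ.integral fun ν => ν U := rfl

/-- `⟨𝓔 ξ, g⟩ = ⟨ξ, ⟨-, g⟩⟩`. -/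
theorem integral_join (ξ : ContinuousValuation (ContinuousValuation X)) {g : X → ℝ≥0∞}
    (hg : LowerSemicontinuous g) :
    (join ξ).integral g = ξ.integral fun ν => ν.integral g := by
  have h : (fun ν : ContinuousValuation X => ν.integral g) =
      fun ν => ⨆ n, ν.integral (approx g n) := by
    ext ν
    rw [← ν.integral_iSup (lsc_approx g) (approx_mono g).directed_le]
    simp only [iSup_approx hg]
  rw [h, ξ.integral_iSup (fun n => lsc_integral (lsc_approx g n)), integral_eq_iSup _ hg]
  · refine iSup_congr fun n => ?_
    have h' : (fun ν : ContinuousValuation X => ν.integral (approx g n)) = fun ν =>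
        ∑ k ∈ Finset.range (4 ^ n), (2 ^ n)⁻¹ * ν (level g ((k + 1) / 2 ^ n)) :=
      funext fun ν => ν.integral_sum_ind _ _ _
    rw [h', ξ.integral_finsetSum _ fun k => lsc_const_mul _ (lsc_apply _)]
    exact Finset.sum_congr rfl fun k _ => (ξ.integral_const_mul _ (lsc_apply _)).symm
  · refine Monotone.directed_le fun m n hmn ν => ?_
    change ν.integral _ ≤ ν.integral _
    rw [ν.integral_eq_layer (lsc_approx g m), ν.integral_eq_layer (lsc_approx g n)]
    exact ν.layer_mono (approx_mono g hmn)

theorem continuous_join :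
    Continuous (join : ContinuousValuation (ContinuousValuation X) → ContinuousValuation X) :=
  continuous_iff_lsc.2 fun U => lsc_integral (lsc_apply U)

/-- The slice map `j_x : Y → X × Y`, `y ↦ (x, y)`. -/
def slice (x : X) : C(Y, X × Y) := ⟨fun y => (x, y), by fun_prop⟩

/-- The product `U × V` of open sets. -/
def openProd (U : Opens X) (V : Opens Y) : Opens (X × Y) :=
  ⟨(U : Set X) ×ˢ (V : Set Y), U.isOpen.prod V.isOpen⟩

/-- The map `s (x, ν) = (j_x)_* ν`. -/
def strength (x : X) (ν : ContinuousValuation Y) : ContinuousValuation (X × Y) :=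
  ν.map (slice x)

end ContinuousValuation

/-- The functor `V : Top ⥤ Top`. -/
noncomputable def valuationFunctor : TopCat.{u} ⥤ TopCat.{u} where
  obj X := TopCat.of (ContinuousValuation X)
  map f := TopCat.ofHom ⟨ContinuousValuation.map f.hom, ContinuousValuation.continuous_map f.hom⟩

/-- The valuation monad `(V, δ, 𝓔)`. -/
noncomputable def valuationMonad : Monad TopCat.{u} where
  toFunctor := valuationFunctor
  η :=
    { app := fun X => TopCat.ofHom
        ⟨fun x : X => ContinuousValuation.dirac x, ContinuousValuation.continuous_dirac⟩
      naturality := fun X Y f => by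
        ext x
        rfl }
  μ :=
    { app := fun X => TopCat.ofHom
        ⟨fun ξ : ContinuousValuation (ContinuousValuation X) => ContinuousValuation.join ξ,
          ContinuousValuation.continuous_join⟩
      naturality := fun X Y f => by
        ext ξ
        refine ContinuousValuation.ext fun U => ?_
        exact ContinuousValuation.integral_map _ _ (ContinuousValuation.lsc_apply U) }
  assoc X := by
    ext ξ
    refine ContinuousValuation.ext fun U => ?_
    refine (ContinuousValuation.integral_map _ _ (ContinuousValuation.lsc_apply U)).trans ?_
    exact (ContinuousValuation.integral_join _ (ContinuousValuation.lsc_apply U)).symm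
  left_unit X := by
    ext ν
    refine ContinuousValuation.ext fun U => ?_
    exact ContinuousValuation.integral_dirac _ (ContinuousValuation.lsc_apply U)
  right_unit X := by
    ext ν
    refine ContinuousValuation.ext fun U => ?_
    refine (ContinuousValuation.integral_map _ _ (ContinuousValuation.lsc_apply U)).trans ?_
    exact ContinuousValuation.integral_ind _ U

section Monads

variable {C : Type*} [Category C] [MonoidalCategory C]

/-- A strength on a monad `T` on a monoidal category. -/
structure MonadStrength (T : Monad C) where
  app (X Y : C) : X ⊗ T.obj Y ⟶ T.obj (X ⊗ Y)
  naturality_left {X X' : C} (f : X ⟶ X') (Y : C) :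
    (f ▷ T.obj Y) ≫ app X' Y = app X Y ≫ T.map (f ▷ Y)
  naturality_right (X : C) {Y Y' : C} (g : Y ⟶ Y') :
    (X ◁ T.map g) ≫ app X Y' = app X Y ≫ T.map (X ◁ g)
  unitor (X : C) : app (𝟙_ C) X ≫ T.map (λ_ X).hom = (λ_ (T.obj X)).hom
  associator (X Y Z : C) :
    app (X ⊗ Y) Z ≫ T.map (α_ X Y Z).hom =
      (α_ X Y (T.obj Z)).hom ≫ (X ◁ app Y Z) ≫ app X (Y ⊗ Z)
  unit (X Y : C) : (X ◁ T.η.app Y) ≫ app X Y = T.η.app (X ⊗ Y)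
  mul (X Y : C) :
    app X (T.obj Y) ≫ T.map (app X Y) ≫ T.μ.app (X ⊗ Y) = (X ◁ T.μ.app Y) ≫ app X Y

variable [SymmetricCategory C]

/-- The costrength induced by a strength through the symmetry. -/
def MonadStrength.costrength {T : Monad C} (s : MonadStrength T) (X Y : C) :
    T.obj X ⊗ Y ⟶ T.obj (X ⊗ Y) :=
  (β_ (T.obj X) Y).hom ≫ s.app Y X ≫ T.map (β_ Y X).hom

/-- The upper composite `T X ⊗ T Y ⟶ T (X ⊗ Y)` of the commutativity diagram. -/
def MonadStrength.prod {T : Monad C} (s : MonadStrength T) (X Y : C) :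
    T.obj X ⊗ T.obj Y ⟶ T.obj (X ⊗ Y) :=
  s.app (T.obj X) Y ≫ T.map (s.costrength X Y) ≫ T.μ.app (X ⊗ Y)

/-- A strong monad is commutative if the two composites `T X ⊗ T Y ⟶ T (X ⊗ Y)` agree. -/
def MonadStrength.IsCommutative {T : Monad C} (s : MonadStrength T) : Prop :=
  ∀ X Y : C, s.prod X Y =
    s.costrength X (T.obj Y) ≫ T.map (s.app X Y) ≫ T.μ.app (X ⊗ Y)

/-- The structure of a symmetric monoidal monad on a monad `T`: a lax symmetric monoidal structure
on the underlying functor which is compatible with unit and multiplication. -/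
structure SymmetricMonoidalMonadStruct (T : Monad C) where
  lax : T.toFunctor.LaxBraided
  unit_eq : lax.toLaxMonoidal.ε = T.η.app (𝟙_ C)
  unit_prod (X Y : C) :
    (T.η.app X ⊗ₘ T.η.app Y) ≫ lax.toLaxMonoidal.μ X Y = T.η.app (X ⊗ Y)
  mul_prod (X Y : C) :
    lax.toLaxMonoidal.μ (T.obj X) (T.obj Y) ≫ T.map (lax.toLaxMonoidal.μ X Y) ≫
      T.μ.app (X ⊗ Y) = (T.μ.app X ⊗ₘ T.μ.app Y) ≫ lax.toLaxMonoidal.μ X Y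

end Monads

/-- The product valuation `ν ⊗ ρ` given by a symmetric monoidal structure on the valuation monad. -/
noncomputable def SymmetricMonoidalMonadStruct.product
    (M : SymmetricMonoidalMonadStruct valuationMonad.{u}) {X Y : TopCat.{u}}
    (ν : ContinuousValuation X) (ρ : ContinuousValuation Y) : ContinuousValuation (X × Y) :=
  M.lax.toLaxMonoidal.μ X Y (ν, ρ)

namespace ContinuousValuation

variable {X Y Z : Type*} [TopologicalSpace X] [TopologicalSpace Y] [TopologicalSpace Z]

/-! Everything rests on two facts about products.

The first is joint continuity of the strength (`continuous_strength`). If `ν` gives the `x`-slice of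
an open `O` mass greater than `r`, then Scott continuity finds a rectangle `U × V ⊆ O` with `x ∈ U`
and `r < ν V`. The same rectangle bounds the mass of nearby slices under nearby valuations. Hence
partial integrals of lower semicontinuous functions are lower semicontinuous, iterated integrals
make sense, and the two composites `𝓔 ∘ t_* ∘ s` and `𝓔 ∘ s_* ∘ t` are the two orders of iterated
integration.

The second is uniqueness (`ext_openProd`). Open rectangles form a basis closed under intersection,
so modularity determines a valuation on finite unions of rectangles and Scott continuity determines
it on all open sets. Both iterated integrals give `ν U * ρ V` on `U × V`, so they coincide. This is
at once commutativity of the monad and Fubini's theorem, with no finiteness assumption on `ν` or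
`ρ`.

The axioms of a symmetric monoidal monad then follow by comparing either values on rectangles or
iterated integrals, the order of integration being free. -/

theorem lsc_ind (U : Opens X) : LowerSemicontinuous (ind U) := by
  simpa using lsc_mul_ind 1 U

/-! ### Open rectangles and uniqueness of valuations on a product -/

theorem mem_openProd {U : Opens X} {V : Opens Y} {p : X × Y} :
    p ∈ openProd U V ↔ p.1 ∈ U ∧ p.2 ∈ V := Iff.rfl

theorem ind_openProd (U : Opens X) (V : Opens Y) (p : X × Y) :
    ind (openProd U V) p = ind U p.1 * ind V p.2 := by
  by_cases h₁ : p.1 ∈ U <;> by_cases h₂ : p.2 ∈ V <;> simp [ind, mem_openProd, h₁, h₂]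

theorem openProd_inf (U U' : Opens X) (V V' : Opens Y) :
    openProd U V ⊓ openProd U' V' = openProd (U ⊓ U') (V ⊓ V') :=
  Opens.ext Set.prod_inter_prod

/-- Continuous valuations that agree on a basis closed under binary intersections are equal. -/
theorem ext_of_isBasis {B : Set (Opens X)} (hB : Opens.IsBasis B)
    (hinf : ∀ U ∈ B, ∀ V ∈ B, U ⊓ V ∈ B) {ν ρ : ContinuousValuation X}
    (h : ∀ U ∈ B, ν U = ρ U) : ν = ρ := by
  classical
  -- Inclusion–exclusion, by induction on a bound for the number of basic sets. A bound is used
  -- rather than the exact cardinality because distinct `V` may have the same intersection with `U`.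
  have hfin : ∀ n : ℕ, ∀ s : Finset (Opens X), s.card ≤ n → (∀ U ∈ s, U ∈ B) →
      ν (s.sup id) = ρ (s.sup id) := by
    intro n
    induction n with
    | zero =>
      intro s hs _
      rw [Finset.card_eq_zero.1 (Nat.le_zero.1 hs), Finset.sup_empty, ν.strict', ρ.strict']
    | succ n ih =>
      intro s hs hsB
      rcases s.eq_empty_or_nonempty with rfl | ⟨U, hUs⟩
      · rw [Finset.sup_empty, ν.strict', ρ.strict']
      obtain ⟨t, hU, rfl⟩ : ∃ t, U ∉ t ∧ insert U t = s :=
        ⟨s.erase U, Finset.notMem_erase U s, Finset.insert_erase hUs⟩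
      have ht : t.card ≤ n := by
        rw [Finset.card_insert_of_notMem hU] at hs
        exact Nat.le_of_succ_le_succ hs
      have hUB := hsB U (Finset.mem_insert_self U t)
      have htB : ∀ V ∈ t, V ∈ B := fun V hV => hsB V (Finset.mem_insert_of_mem hV)
      have hcap : ν (U ⊓ t.sup id) = ρ (U ⊓ t.sup id) := by
        have himg : U ⊓ t.sup id = (t.image (U ⊓ ·)).sup id := by
          rw [Finset.sup_inf_distrib_left, Finset.sup_image]
          rfl
        rw [himg]
        refine ih _ (Finset.card_image_le.trans ht) fun W hW => ?_
        obtain ⟨V, hV, rfl⟩ := Finset.mem_image.1 hW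
        exact hinf U hUB V (htB V hV)
      rw [Finset.sup_insert, id]
      have hν := ν.modular' U (t.sup id)
      have hρ := ρ.modular' U (t.sup id)
      rw [h U hUB, ih t ht htB, ← hρ, hcap] at hν
      -- The modular law can be cancelled only when the intersection has finite mass. If that mass
      -- is infinite, monotonicity makes both valuations infinite on the union.
      rcases eq_or_ne (ρ (U ⊓ t.sup id)) ∞ with htop | htop
      · have hm : U ⊓ t.sup id ≤ U ⊔ t.sup id := inf_le_left.trans le_sup_left
        rw [top_le_iff.1 (htop.symm.trans_le (ρ.mono' hm)),
          top_le_iff.1 ((hcap.trans htop).symm.trans_le (ν.mono' hm))]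
      · exact (ENNReal.add_left_inj htop).1 hν
  refine ext fun U => ?_
  obtain ⟨S, hS, rfl⟩ := Opens.isBasis_iff_cover.1 hB U
  -- An arbitrary union is the directed union of its finite subunions, which is the form Scott
  -- continuity needs.
  have hsup : sSup S = ⨆ s : {s : Finset (Opens X) // ∀ V ∈ s, V ∈ S}, s.1.sup id := by
    refine le_antisymm (sSup_le fun V hV => ?_) (iSup_le fun s => Finset.sup_le fun V hV =>
      le_sSup (s.2 V hV))
    refine le_iSup_of_le ⟨{V}, by simpa using hV⟩ ?_
    simp
  have : Nonempty {s : Finset (Opens X) // ∀ V ∈ s, V ∈ S} := ⟨∅, by simp⟩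
  have hdir : Directed (· ≤ ·) fun s : {s : Finset (Opens X) // ∀ V ∈ s, V ∈ S} =>
      s.1.sup id := fun s t => ⟨⟨s.1 ∪ t.1, fun V hV => (Finset.mem_union.1 hV).elim (s.2 V) (t.2 V)⟩,
      Finset.sup_mono Finset.subset_union_left, Finset.sup_mono Finset.subset_union_right⟩
  rw [hsup, ν.apply_iSup hdir, ρ.apply_iSup hdir]
  exact iSup_congr fun s => hfin _ s.1 le_rfl fun V hV => hS (s.2 V hV)

theorem isBasis_openProd :
    Opens.IsBasis {O : Opens (X × Y) | ∃ U V, O = openProd U V} := by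
  refine Opens.isBasis_iff_nbhd.2 fun {O p} hp => ?_
  obtain ⟨U, V, hU, hV, hpU, hpV, hO⟩ := isOpen_prod_iff.1 O.isOpen p.1 p.2 hp
  exact ⟨openProd ⟨U, hU⟩ ⟨V, hV⟩, ⟨_, _, rfl⟩, ⟨hpU, hpV⟩, hO⟩

/-- Continuous valuations on a product are determined by their values on open rectangles. -/
theorem ext_openProd {ν ρ : ContinuousValuation (X × Y)}
    (h : ∀ U V, ν (openProd U V) = ρ (openProd U V)) : ν = ρ := by
  refine ext_of_isBasis isBasis_openProd ?_ ?_
  · rintro _ ⟨U, V, rfl⟩ _ ⟨U', V', rfl⟩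
    exact ⟨_, _, openProd_inf U U' V V'⟩
  · rintro _ ⟨U, V, rfl⟩
    exact h U V

/-! ### Continuity of the strength and of partial integrals -/

/-- Scott continuity of `ν` takes the place of any local compactness assumption: the slice of `O` at
`x` is exhausted by a directed family of open sets `V`, each of which stays in the slice throughout
a neighbourhood of `x`. -/
theorem continuous_strength :
    Continuous fun p : X × ContinuousValuation Y => strength p.1 p.2 := by
  refine continuous_iff_lsc.2 fun O => ?_
  rintro ⟨x, ν⟩ r hr
  let D : Set (Opens Y) := {V | ∃ U : Opens X, x ∈ U ∧ openProd U V ≤ O}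
  have hD : D.Nonempty := ⟨⊥, ⊤, trivial, fun p hp => hp.2.elim⟩
  have hdir : DirectedOn (· ≤ ·) D := by
    rintro V ⟨U, hxU, hU⟩ V' ⟨U', hxU', hU'⟩
    -- Enlarging `V` costs shrinking `U`; finitely many shrinkings still leave a neighbourhood of
    -- `x`.
    refine ⟨V ⊔ V', ⟨U ⊓ U', ⟨hxU, hxU'⟩, ?_⟩, le_sup_left, le_sup_right⟩
    rintro p ⟨hp, hp' | hp'⟩
    · exact hU ⟨hp.1, hp'⟩
    · exact hU' ⟨hp.2, hp'⟩
  have hsup : Opens.comap (slice x) O ≤ sSup D := by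
    intro y hy
    obtain ⟨U, V, hU, hV, hxU, hyV, hO⟩ := isOpen_prod_iff.1 O.isOpen x y hy
    exact Opens.mem_sSup.2 ⟨⟨V, hV⟩, ⟨⟨U, hU⟩, hxU, hO⟩, hyV⟩
  have hr' : r < ⨆ V ∈ D, ν V := by
    rw [← ν.scott' D hD hdir]
    exact lt_of_lt_of_le hr (ν.mono' hsup)
  obtain ⟨V, ⟨U, hxU, hU⟩, hV⟩ : ∃ V ∈ D, r < ν V := by
    simpa only [lt_iSup_iff, exists_prop] using hr'
  -- The neighbourhood is `U × {ν' | r < ν' V}`: for `x' ∈ U` the slice of `O` at `x'` still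
  -- contains `V`.
  filter_upwards [prod_mem_nhds (U.isOpen.mem_nhds hxU) (lsc_apply V ν r hV)]
  rintro ⟨x', ν'⟩ ⟨hx', hν'⟩
  exact lt_of_lt_of_le hν' (ν'.mono' fun y hy => hU ⟨hx', hy⟩)

theorem integral_strength (x : X) (ν : ContinuousValuation Y) {f : X × Y → ℝ≥0∞}
    (hf : LowerSemicontinuous f) : (strength x ν).integral f = ν.integral fun y => f (x, y) :=
  integral_map _ _ hf

/-- The partial integral at `x` is the integral of `f` against `strength x ν`, which depends
continuously on `x`. This makes the outer integral in Fubini's theorem an integral of a lower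
semicontinuous function. -/
theorem lsc_integral_right (ν : ContinuousValuation Y) {f : X × Y → ℝ≥0∞}
    (hf : LowerSemicontinuous f) : LowerSemicontinuous fun x => ν.integral fun y => f (x, y) := by
  have h := (lsc_integral hf).comp
    (continuous_strength.comp (by fun_prop : Continuous fun x : X => (x, ν)))
  simpa only [Function.comp_def, integral_strength _ _ hf] using h

/-- The map `t (ν, y) = (x ↦ (x, y))_* ν`. -/
def costrength (ν : ContinuousValuation X) (y : Y) : ContinuousValuation (X × Y) :=
  ν.map ⟨fun x => (x, y), by fun_prop⟩

theorem continuous_costrength :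
    Continuous fun p : ContinuousValuation X × Y => costrength p.1 p.2 :=
  (continuous_map ⟨Prod.swap, continuous_swap⟩).comp (continuous_strength.comp continuous_swap)

theorem integral_costrength (ν : ContinuousValuation X) (y : Y) {f : X × Y → ℝ≥0∞}
    (hf : LowerSemicontinuous f) : (costrength ν y).integral f = ν.integral fun x => f (x, y) :=
  integral_map _ _ hf

theorem lsc_integral_left (ν : ContinuousValuation X) {f : X × Y → ℝ≥0∞}
    (hf : LowerSemicontinuous f) : LowerSemicontinuous fun y => ν.integral fun x => f (x, y) :=
  lsc_integral_right ν (hf.comp continuous_swap)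

/-! ### Product valuations and Fubini's theorem -/

/-- The product valuation `𝓔 (t_* (s (ν, ρ)))`. -/
noncomputable def prod (ν : ContinuousValuation X) (ρ : ContinuousValuation Y) :
    ContinuousValuation (X × Y) :=
  join ((strength ν ρ).map ⟨fun p => costrength p.1 p.2, continuous_costrength⟩)

/-- The product valuation `𝓔 (s_* (t (ν, ρ)))`. -/
noncomputable def prod' (ν : ContinuousValuation X) (ρ : ContinuousValuation Y) :
    ContinuousValuation (X × Y) :=
  join ((costrength ν ρ).map ⟨fun p => strength p.1 p.2, continuous_strength⟩)

/-- Integrals against `𝓔`, pushforwards and strengths unfold one after another. In `s (ν, ρ)` only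
the second variable is spread out, by `ρ`, so `ρ` becomes the outer integral; `prod'` yields the
opposite order. -/
theorem integral_prod (ν : ContinuousValuation X) (ρ : ContinuousValuation Y)
    {f : X × Y → ℝ≥0∞} (hf : LowerSemicontinuous f) :
    (prod ν ρ).integral f = ρ.integral fun y => ν.integral fun x => f (x, y) := by
  rw [prod, integral_join _ hf, integral_map _ _ (lsc_integral hf),
    integral_strength _ _ ((lsc_integral hf).comp (ContinuousMap.continuous _))]
  simp only [Function.comp_apply, ContinuousMap.coe_mk, integral_costrength _ _ hf]

theorem integral_prod' (ν : ContinuousValuation X) (ρ : ContinuousValuation Y)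
    {f : X × Y → ℝ≥0∞} (hf : LowerSemicontinuous f) :
    (prod' ν ρ).integral f = ν.integral fun x => ρ.integral fun y => f (x, y) := by
  rw [prod', integral_join _ hf, integral_map _ _ (lsc_integral hf),
    integral_costrength _ _ ((lsc_integral hf).comp (ContinuousMap.continuous _))]
  simp only [Function.comp_apply, ContinuousMap.coe_mk, integral_strength _ _ hf]

theorem integral_mul_const (ν : ContinuousValuation X) (c : ℝ≥0∞) {g : X → ℝ≥0∞}
    (hg : LowerSemicontinuous g) : ν.integral (fun x => g x * c) = ν.integral g * c := by
  simpa only [mul_comm _ c] using ν.integral_const_mul c hg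

theorem prod_openProd (ν : ContinuousValuation X) (ρ : ContinuousValuation Y)
    (U : Opens X) (V : Opens Y) : prod ν ρ (openProd U V) = ν U * ρ V := by
  rw [← integral_ind, integral_prod _ _ (lsc_ind _)]
  simp only [ind_openProd, integral_mul_const _ _ (lsc_ind _), integral_ind,
    integral_const_mul _ _ (lsc_ind _)]

theorem prod'_openProd (ν : ContinuousValuation X) (ρ : ContinuousValuation Y)
    (U : Opens X) (V : Opens Y) : prod' ν ρ (openProd U V) = ν U * ρ V := by
  rw [← integral_ind, integral_prod' _ _ (lsc_ind _)]
  simp only [ind_openProd, integral_mul_const _ _ (lsc_ind _), integral_ind,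
    integral_const_mul _ _ (lsc_ind _)]

/-- The core of commutativity and of Fubini: the order of integration is invisible on rectangles,
and rectangles determine the valuation. -/
theorem prod'_eq_prod (ν : ContinuousValuation X) (ρ : ContinuousValuation Y) :
    prod' ν ρ = prod ν ρ :=
  ext_openProd fun U V => by rw [prod_openProd, prod'_openProd]

/-- Fubini's theorem. -/
theorem integral_prod_symm (ν : ContinuousValuation X) (ρ : ContinuousValuation Y)
    {f : X × Y → ℝ≥0∞} (hf : LowerSemicontinuous f) :
    (prod ν ρ).integral f = ν.integral fun x => ρ.integral fun y => f (x, y) := by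
  rw [← prod'_eq_prod, integral_prod' _ _ hf]

/-- Multiplication on `[0,∞]` is not continuous at `(0, ∞)`, but it preserves suprema in each
variable. The product is therefore a supremum of products of dyadic approximations, which are finite
sums of multiples of indicators of rectangles. -/
theorem lsc_mul_prod {g : X → ℝ≥0∞} {h : Y → ℝ≥0∞} (hg : LowerSemicontinuous g)
    (hh : LowerSemicontinuous h) : LowerSemicontinuous fun p : X × Y => g p.1 * h p.2 := by
  have : (fun p : X × Y => g p.1 * h p.2) =
      fun p => ⨆ m, ⨆ n, approx g m p.1 * approx h n p.2 := by
    ext p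
    simp only [← ENNReal.mul_iSup, ← ENNReal.iSup_mul, iSup_approx hg, iSup_approx hh]
  rw [this]
  refine lowerSemicontinuous_iSup fun m => lowerSemicontinuous_iSup fun n => ?_
  simp only [approx, Finset.sum_mul_sum]
  refine lowerSemicontinuous_sum fun k _ => lowerSemicontinuous_sum fun l _ => ?_
  simp only [mul_mul_mul_comm _ (ind _ _), ← ind_openProd]
  exact lsc_mul_ind _ _

theorem integral_prod_mul (ν : ContinuousValuation X) (ρ : ContinuousValuation Y)
    {g : X → ℝ≥0∞} {h : Y → ℝ≥0∞} (hg : LowerSemicontinuous g) (hh : LowerSemicontinuous h) :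
    (prod ν ρ).integral (fun p => g p.1 * h p.2) = ν.integral g * ρ.integral h := by
  rw [integral_prod _ _ (lsc_mul_prod hg hh)]
  simp only [integral_mul_const _ _ hg, integral_const_mul _ _ hh]

/-! ### Compatibility of the product with pushforward, associativity, units, symmetry and `𝓔` -/

theorem continuous_prod :
    Continuous fun p : ContinuousValuation X × ContinuousValuation Y => prod p.1 p.2 :=
  continuous_join.comp ((continuous_map _).comp continuous_strength)

theorem prod_map_left (f : C(X, Z)) (ν : ContinuousValuation X) (ρ : ContinuousValuation Y) :
    prod (ν.map f) ρ = (prod ν ρ).map (f.prodMap (ContinuousMap.id Y)) :=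
  ext_openProd fun U V => (prod_openProd _ _ _ _).trans
    (prod_openProd ν ρ (Opens.comap f U) V).symm

theorem prod_map_right (f : C(Y, Z)) (ν : ContinuousValuation X) (ρ : ContinuousValuation Y) :
    prod ν (ρ.map f) = (prod ν ρ).map ((ContinuousMap.id X).prodMap f) :=
  ext_openProd fun U V => (prod_openProd _ _ _ _).trans
    (prod_openProd ν ρ U (Opens.comap f V)).symm

/-- Both sides integrate the indicator of `O` as the same triple integral, with `ν` outermost and
`σ` innermost. -/
theorem prod_assoc (ν : ContinuousValuation X) (ρ : ContinuousValuation Y)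
    (σ : ContinuousValuation Z) :
    (prod (prod ν ρ) σ).map ⟨fun p => (p.1.1, p.1.2, p.2), by fun_prop⟩ =
      prod ν (prod ρ σ) := by
  refine ext fun O => ?_
  have hO := lsc_ind (X := X × Y × Z) O
  rw [← integral_ind, ← integral_ind, integral_map _ _ hO, integral_prod_symm _ _ hO,
    integral_prod_symm _ _ (hO.comp (ContinuousMap.continuous _)),
    integral_prod_symm _ _ (lsc_integral_right σ (hO.comp (ContinuousMap.continuous _)))]
  congr 1
  ext x
  exact (integral_prod_symm ρ σ (hO.comp (slice x).continuous)).symm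

/-- With `x` as the outer variable, the integral against `dirac x` is evaluation at `x`. This
recovers the strength from the product and yields left unitality. -/
theorem dirac_prod (x : X) (ν : ContinuousValuation Y) : prod (dirac x) ν = strength x ν := by
  refine ext fun O => ?_
  rw [← integral_ind, ← integral_ind, integral_prod_symm _ _ (lsc_ind O),
    integral_dirac _ (lsc_integral_right ν (lsc_ind O)), integral_strength _ _ (lsc_ind O)]

theorem prod_dirac (ν : ContinuousValuation X) (y : Y) : prod ν (dirac y) = costrength ν y := by
  refine ext fun O => ?_
  rw [← integral_ind, ← integral_ind, integral_prod _ _ (lsc_ind O),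
    integral_dirac _ (lsc_integral_left ν (lsc_ind O)), integral_costrength _ _ (lsc_ind O)]

/-- Swapping the factors exchanges the two iterated integrals, so symmetry is Fubini's theorem
again. -/
theorem prod_swap (ν : ContinuousValuation X) (ρ : ContinuousValuation Y) :
    (prod ν ρ).map ⟨Prod.swap, continuous_swap⟩ = prod ρ ν := by
  refine ext fun O => ?_
  rw [← integral_ind, ← integral_ind, integral_map _ _ (lsc_ind O),
    integral_prod _ _ ((lsc_ind O).comp (ContinuousMap.continuous _)), integral_prod_symm _ _ (lsc_ind O)]
  rfl

/-- On `U × V` the left side integrates the function `(ν, ρ) ↦ ν U * ρ V` against `prod ξ η`; this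
has separated variables, so the integral factors. -/
theorem join_prod (ξ : ContinuousValuation (ContinuousValuation X))
    (η : ContinuousValuation (ContinuousValuation Y)) :
    join ((prod ξ η).map ⟨fun p => prod p.1 p.2, continuous_prod⟩) = prod (join ξ) (join η) := by
  refine ext_openProd fun U V => ?_
  rw [prod_openProd, join_apply, integral_map _ _ (lsc_apply _)]
  simp only [Function.comp_def, ContinuousMap.coe_mk, prod_openProd]
  exact integral_prod_mul ξ η (lsc_apply U) (lsc_apply V)

end ContinuousValuation

/-! ### The strength and the symmetric monoidal structure on the monad -/

section Categorical

open ContinuousValuation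

/-- The strength of the valuation monad. -/
noncomputable def valuationStrength : MonadStrength valuationMonad.{u} where
  app X Y := TopCat.ofHom
    ⟨fun p : X × ContinuousValuation Y => strength p.1 p.2, continuous_strength⟩
  naturality_left f Y := rfl
  naturality_right X Y Y' g := rfl
  unitor X := rfl
  associator X Y Z := rfl
  unit X Y := rfl
  mul X Y := by
    refine TopCat.ext ?_
    rintro ⟨x, ξ⟩
    refine ContinuousValuation.ext fun O => ?_
    -- Both sides are the `ξ`-integral of the mass of the slice of `O` at `x`. The other axioms
    -- compare only pushforwards and Dirac valuations and hold definitionally.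
    refine (integral_map _ _ (lsc_apply O)).trans ?_
    exact integral_map _ _ ((lsc_apply O).comp (ContinuousMap.continuous _))

theorem valuationStrength_app (X Y : TopCat.{u}) (x : X) (ν : ContinuousValuation Y) :
    valuationStrength.app X Y (x, ν) = strength x ν := rfl

theorem valuationStrength_costrength (X Y : TopCat.{u}) (ν : ContinuousValuation X) (y : Y) :
    valuationStrength.costrength X Y (ν, y) = costrength ν y := rfl

/-- At a pair `(ν, ρ)` the two composites are, by definition, `prod ν ρ` and `prod' ν ρ`. -/
theorem valuationStrength_isCommutative : valuationStrength.{u}.IsCommutative := by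
  intro X Y
  refine TopCat.ext ?_
  rintro ⟨ν, ρ⟩
  exact (prod'_eq_prod ν ρ).symm

/-- The lax symmetric monoidal structure on `V` given by the product valuations. -/
@[reducible]
noncomputable def valuationLax : valuationMonad.{u}.toFunctor.LaxBraided where
  ε := valuationMonad.η.app (𝟙_ TopCat)
  μ X Y := valuationStrength.prod X Y
  μ_natural_left {X Y} f Z := by
    refine TopCat.ext ?_
    rintro ⟨ν, ρ⟩
    exact prod_map_left f.hom ν ρ
  μ_natural_right {X Y} Z f := by
    refine TopCat.ext ?_
    rintro ⟨ν, ρ⟩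
    exact prod_map_right f.hom ν ρ
  associativity X Y Z := by
    refine TopCat.ext ?_
    rintro ⟨⟨ν, ρ⟩, σ⟩
    exact prod_assoc ν ρ σ
  left_unitality X := by
    refine TopCat.ext ?_
    rintro ⟨x, ν⟩
    -- The product with a Dirac valuation is a pushforward along a slice, which the second
    -- projection undoes.
    exact (congrArg (map ⟨Prod.snd, continuous_snd⟩) (dirac_prod x ν)).symm
  right_unitality X := by
    refine TopCat.ext ?_
    rintro ⟨ν, x⟩
    exact (congrArg (map ⟨Prod.fst, continuous_fst⟩) (prod_dirac ν x)).symm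
  braided X Y := by
    refine TopCat.ext ?_
    rintro ⟨ν, ρ⟩
    exact prod_swap ν ρ

/-- The valuation monad is a symmetric monoidal monad. -/
noncomputable def valuationSymmetricMonoidal :
    SymmetricMonoidalMonadStruct valuationMonad.{u} where
  lax := valuationLax
  unit_eq := rfl
  unit_prod X Y := by
    refine TopCat.ext ?_
    rintro ⟨x, y⟩
    -- The pushforward of `dirac y` along the slice at `x` is the Dirac valuation at `(x, y)` by
    -- definition.
    exact dirac_prod x (dirac y)
  mul_prod X Y := by
    refine TopCat.ext ?_
    rintro ⟨ξ, η⟩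
    exact join_prod ξ η

end Categorical

theorem mainTheorem6 :
    -- `s (x, ν) = (j_x)_* ν` is jointly continuous
    (∀ (X Y : Type u) [TopologicalSpace X] [TopologicalSpace Y],
      Continuous fun p : X × ContinuousValuation Y => ContinuousValuation.strength p.1 p.2) ∧
    -- it is a strength, with costrength `t (ν, y) = (x ↦ (x, y))_* ν`, and it is commutative
    ∃ s : MonadStrength valuationMonad.{u},
      (∀ (X Y : TopCat.{u}) (x : X) (ν : ContinuousValuation Y),
        s.app X Y (x, ν) = ContinuousValuation.strength x ν) ∧
      (∀ (X Y : TopCat.{u}) (ν : ContinuousValuation X) (y : Y),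
        s.costrength X Y (ν, y) = ν.map ⟨fun x => (x, y), by fun_prop⟩) ∧
      s.IsCommutative ∧
      -- the corresponding symmetric monoidal monad structure
      ∃ M : SymmetricMonoidalMonadStruct valuationMonad.{u},
        (∀ X Y : TopCat.{u}, M.lax.toLaxMonoidal.μ X Y = s.prod X Y) ∧
        (∀ X Y : TopCat.{u},
          s.app X Y = (valuationMonad.η.app X ▷ valuationMonad.obj Y) ≫
            M.lax.toLaxMonoidal.μ X Y) ∧
        -- the product valuations
        ∀ (X Y : TopCat.{u}) (ν : ContinuousValuation X) (ρ : ContinuousValuation Y),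
          (∀ (U : TopologicalSpace.Opens X) (V : TopologicalSpace.Opens Y),
            M.product ν ρ (ContinuousValuation.openProd U V) = ν U * ρ V) ∧
          (∀ (g : X → ℝ≥0∞) (h : Y → ℝ≥0∞),
            LowerSemicontinuous g → LowerSemicontinuous h →
            (M.product ν ρ).integral (fun p => g p.1 * h p.2) = ν.integral g * ρ.integral h) ∧
          (∀ f : X × Y → ℝ≥0∞, LowerSemicontinuous f →
            (M.product ν ρ).integral f = ν.integral (fun x => ρ.integral fun y => f (x, y)) ∧
            (M.product ν ρ).integral f = ρ.integral (fun y => ν.integral fun x => f (x, y))) := by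
  refine ⟨fun X Y _ _ => ContinuousValuation.continuous_strength, valuationStrength,
    valuationStrength_app, valuationStrength_costrength, valuationStrength_isCommutative,
    valuationSymmetricMonoidal, fun X Y => rfl, fun X Y => ?_, fun X Y ν ρ => ⟨?_, ?_, ?_⟩⟩
  · refine TopCat.ext ?_
    rintro ⟨x, ν⟩
    exact (ContinuousValuation.dirac_prod x ν).symm
  · exact ContinuousValuation.prod_openProd ν ρ
  · exact fun g h hg hh => ContinuousValuation.integral_prod_mul ν ρ hg hh
  · exact fun f hf => ⟨ContinuousValuation.integral_prod_symm ν ρ hf,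
      ContinuousValuation.integral_prod ν ρ hf⟩
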